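/- **Theorem.** There is a deterministic congested-clique algorithm that, given an Eulerian graph $G=(V,E)$ (a finite simple graph, not necessarily connected, in which every vertex has even degree), finds an Eulerian orientation of $G$, i.e. an orientation of the edges such that every vertex has equal in-degree and out-degree, in $O(\log n\,\log^* n)$ rounds, where $n=|V|$. Here the congested clique consists of one processor (node) per vertex of $G$, communicating in synchronous rounds. In each round every node sends a message of $O(\log n)$ bits to each other node (the messages to different nodes may differ), and then updates its state; all nodes run the same program, local computation is free, and complexity is the number of rounds. Nodes have unique identifiers of $O(\log n)$ bits, and each node numbers its $n-1$ links arbitrarily. Initially a node knows $n$, its own identifier, which of its links are edges of $G$, and the identifiers of its neighbours in $G$. At the end every node knows the direction of each edge of $G$ incident to it. The hidden constants may depend on the constant in the bound on the identifier length, but not on $G$, the identifiers or the link numbering. Finally, $\log^* n$ is the least $k\ge 0$ such that applying $\log_2$ to $n$ exactly $k$ times gives a value at most $1$. -/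

import Mathlib

open Filter Asymptotics

/-- The iterated logarithm `log* x`: the least number of times that the base-two logarithm has to
be applied to `x` to reach a value that is at most `1`. -/
noncomputable def logStar (x : ℝ) : ℕ :=
  sInf {k : ℕ | (Real.logb 2)^[k] x ≤ 1}

/-- An Eulerian graph: a finite graph all of whose degrees are even (not necessarily connected). -/
def IsEulerianGraph {V : Type*} [Fintype V] (G : SimpleGraph V) [DecidableRel G.Adj] : Prop :=
  ∀ v, Even (G.degree v)

/-- `D` is an Eulerian orientation of `G`: it directs every edge of `G` in exactly one of the two
directions, has no other arcs, and every vertex has equal in-degree and out-degree. -/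
structure IsEulerianOrientation {V : Type*} (G : SimpleGraph V) (D : Digraph V) : Prop where
  isEdge : ∀ u v, D.Adj u v → G.Adj u v
  oriented : ∀ u v, G.Adj u v → (D.Adj u v ∧ ¬ D.Adj v u) ∨ (D.Adj v u ∧ ¬ D.Adj u v)
  balanced : ∀ v, {u | D.Adj u v}.ncard = {u | D.Adj v u}.ncard

namespace CongestedClique

/-- A port numbering of the clique on `n` nodes: every node `v` numbers its `n - 1` links to the
other nodes arbitrarily; `ports v p` is the node at the other end of the link number `p` of `v`. -/
abbrev PortNumbering (n : ℕ) : Type :=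
  (v : Fin n) → Fin (n - 1) ≃ {u : Fin n // u ≠ v}

/-- The number that `u` gives to its link to the node `v ≠ u`. -/
def PortNumbering.portTo {n : ℕ} (ports : PortNumbering n) (u v : Fin n) (h : v ≠ u) :
    Fin (n - 1) :=
  (ports u).symm ⟨v, h⟩

/-- What a node knows at the beginning (besides `n`): its own identifier, which of its links are
edges of the input graph, and the identifiers of its neighbours in the input graph.
`nbr p = some i` means that link `p` is an edge of the input graph, to the node with identifier `i`;
`nbr p = none` means that link `p` is not an edge of the input graph. -/
structure LocalInput (n : ℕ) where
  id : ℕ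
  nbr : Fin (n - 1) → Option ℕ

/-- The input of the node `v`, for the input graph `G` and the identifiers `ids`. -/
def localInput {n : ℕ} (G : SimpleGraph (Fin n)) [DecidableRel G.Adj] (ids : Fin n → ℕ)
    (ports : PortNumbering n) (v : Fin n) : LocalInput n where
  id := ids v
  nbr p := if G.Adj v (ports v p) then some (ids (ports v p)) else none

/-- A deterministic algorithm in the congested clique, for graph problems where every node has to
output one bit for each of its links. In each synchronous round every node sends over each of its
`n - 1` links a message of `b n` bits, which may differ from link to link, and computes its next
state from its current state and from the messages it receives over its links. All nodes
run the same program, and local computation is free. -/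
structure Algorithm (b : ℕ → ℕ) where
  State : ℕ → Type
  init : (n : ℕ) → LocalInput n → State n
  send : (n : ℕ) → State n → Fin (n - 1) → (Fin (b n) → Bool)
  receive : (n : ℕ) → State n → (Fin (n - 1) → (Fin (b n) → Bool)) → State n
  output : (n : ℕ) → State n → Fin (n - 1) → Bool

namespace Algorithm

variable {b : ℕ → ℕ} (A : Algorithm b) {n : ℕ}

/-- One synchronous round: over its link `p`, the node `v` receives what the node at the other end
of this link sends to `v`. -/
def step (ports : PortNumbering n) (c : Fin n → A.State n) : Fin n → A.State n :=
  fun v => A.receive n (c v) fun p =>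
    A.send n (c (ports v p)) (ports.portTo (ports v p) v (ports v p).2.symm)

/-- The states of all nodes after `t` rounds. -/
def run (G : SimpleGraph (Fin n)) [DecidableRel G.Adj] (ids : Fin n → ℕ)
    (ports : PortNumbering n) (t : ℕ) : Fin n → A.State n :=
  (A.step ports)^[t] fun v => A.init n (localInput G ids ports v)

/-- The digraph on the edges of `G` that the nodes output when they stop after `t` rounds: the edge
`uv` of `G` is directed from `u` to `v` if `u` declares it outgoing (outputs `true` for it). -/
def outputDigraph (G : SimpleGraph (Fin n)) [DecidableRel G.Adj] (ids : Fin n → ℕ)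
    (ports : PortNumbering n) (t : ℕ) : Digraph (Fin n) where
  Adj u v := ∃ h : G.Adj u v,
    A.output n (A.run G ids ports t u) (ports.portTo u v h.ne') = true

end Algorithm

end CongestedClique

/-! Divide and conquer over blocks of nodes. Directing a closed trail along itself balances every
vertex, so a maximal subgraph with an Eulerian orientation leaves a forest, which has at most `n`
edges. Rename nodes by the ranks of their identifiers and let the smaller endpoint own each edge. At
level `k` the owners are grouped into blocks of `2 ^ k`; each block keeps only the edges not yet
oriented, at most `n` of them. To merge two blocks, every node of the union learns both remainders
and orients all but a forest of their union. Nodes of a block make the same fixed choice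
(`eulerPart`, `eulerArcs`), so they agree without coordination. In the block of all nodes the
remaining forest has even degrees, hence is empty (`IsAcyclic.eq_bot_of_even`).

One remainder is `n` messages, fetched in two rounds by `RankComputable.pull`, so a merge costs four
rounds and the total is `4 * (Nat.log 2 n + 1) + 2`, which is O(log n). Since local computation is
free, it suffices that each value is a function of the node's history: this is `Computable`. -/

/-! ### Operations on Eulerian orientations. -/

namespace IsEulerianOrientation

variable {V : Type*}

theorem bot : IsEulerianOrientation (⊥ : SimpleGraph V) ⊥ where
  isEdge _ _ h := h.elim
  oriented _ _ h := h.elim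
  balanced v := by simp

theorem sup [Finite V] {G₁ G₂ : SimpleGraph V} {D₁ D₂ : Digraph V}
    (h₁ : IsEulerianOrientation G₁ D₁) (h₂ : IsEulerianOrientation G₂ D₂)
    (hd : ∀ u v, G₁.Adj u v → ¬ G₂.Adj u v) :
    IsEulerianOrientation (G₁ ⊔ G₂) (D₁ ⊔ D₂) where
  isEdge u v h := h.imp (h₁.isEdge u v) (h₂.isEdge u v)
  oriented u v h := by
    have a₁ := h₁.isEdge u v
    have a₂ := h₁.isEdge v u
    have b₁ := h₂.isEdge u v
    have b₂ := h₂.isEdge v u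
    have hd' := hd u v
    have o₁ := h₁.oriented u v
    have o₂ := h₂.oriented u v
    rw [SimpleGraph.adj_comm] at a₂ b₂
    rw [SimpleGraph.sup_adj] at h
    simp only [Digraph.sup_adj]
    tauto
  balanced v := by
    have hin : {u | (D₁ ⊔ D₂).Adj u v} = {u | D₁.Adj u v} ∪ {u | D₂.Adj u v} := rfl
    have hout : {u | (D₁ ⊔ D₂).Adj v u} = {u | D₁.Adj v u} ∪ {u | D₂.Adj v u} := rfl
    rw [hin, hout, Set.ncard_union_eq, Set.ncard_union_eq, h₁.balanced, h₂.balanced]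
    · exact Set.disjoint_left.2 fun u hu hu' => hd _ _ (h₁.isEdge _ _ hu) (h₂.isEdge _ _ hu')
    · exact Set.disjoint_left.2 fun u hu hu' => hd _ _ (h₁.isEdge _ _ hu) (h₂.isEdge _ _ hu')

theorem comap_equiv {W : Type*} {G : SimpleGraph W} {D : Digraph W}
    (h : IsEulerianOrientation G D) (e : V ≃ W) :
    IsEulerianOrientation (G.comap e) ⟨fun u v => D.Adj (e u) (e v)⟩ where
  isEdge u v := h.isEdge (e u) (e v)
  oriented u v := h.oriented (e u) (e v)
  balanced v := by
    have key : ∀ s : Set W, (e ⁻¹' s).ncard = s.ncard := fun s => by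
      rw [← Set.ncard_image_of_injective _ e.injective, e.image_preimage]
    exact (key {u | D.Adj u (e v)}).trans ((h.balanced (e v)).trans (key {u | D.Adj (e v) u}).symm)

theorem even_ncard_neighborSet [Finite V] {G : SimpleGraph V} {D : Digraph V}
    (h : IsEulerianOrientation G D) (v : V) : Even (G.neighborSet v).ncard := by
  have hs : G.neighborSet v = {u | D.Adj u v} ∪ {u | D.Adj v u} := by
    ext u
    have a₁ := h.isEdge u v
    have a₂ := h.isEdge v u
    have o := h.oriented v u
    rw [SimpleGraph.adj_comm] at a₁
    simp only [SimpleGraph.mem_neighborSet, Set.mem_union, Set.mem_ofPred_eq]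
    tauto
  rw [hs, Set.ncard_union_eq, h.balanced]
  · exact ⟨_, rfl⟩
  · refine Set.disjoint_left.2 fun u (hu : D.Adj u v) (hu' : D.Adj v u) => ?_
    have o := h.oriented v u (h.isEdge _ _ hu')
    tauto

end IsEulerianOrientation

/-! ### Closed trails and forests. -/

namespace SimpleGraph

variable {V : Type*} {G : SimpleGraph V}

/-- The arcs traversed by a walk. -/
def Walk.arcs {u v : V} (p : G.Walk u v) : Digraph V where
  Adj x y := ∃ h : G.Adj x y, (⟨(x, y), h⟩ : G.Dart) ∈ p.darts

/-- Each visit to `x` after the start uses one arc into `x`, and a trail repeats none of them. -/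
theorem Walk.ncard_arcs_in [DecidableEq V] {u v : V} {p : G.Walk u v} (hp : p.IsTrail) (x : V) :
    {y | p.arcs.Adj y x}.ncard = p.support.tail.count x := by
  have hn : p.darts.Nodup := List.Nodup.of_map _ hp.edges_nodup
  have hs : {y | p.arcs.Adj y x} = (fun d : G.Dart => d.fst) ''
      ((p.darts.filter fun d => d.snd = x).toFinset : Set G.Dart) := by
    ext y
    simp only [arcs, Set.mem_ofPred_eq, List.coe_toFinset, List.mem_filter, decide_eq_true_eq,
      Set.mem_image]
    constructor
    · rintro ⟨h, hd⟩
      exact ⟨_, ⟨hd, rfl⟩, rfl⟩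
    · rintro ⟨d, ⟨hd, rfl⟩, rfl⟩
      exact ⟨d.adj, hd⟩
  rw [hs, Set.InjOn.ncard_image, Set.ncard_coe_finset, List.toFinset_card_of_nodup (hn.filter _),
    ← List.countP_eq_length_filter, ← p.map_snd_darts, List.count, List.countP_map]
  · congr 1
  · intro d hd d' hd' h
    simp only [List.coe_toFinset, List.mem_filter, decide_eq_true_eq, Set.mem_ofPred_eq] at hd hd'
    exact Dart.ext _ _ (Prod.ext h (hd.2.trans hd'.2.symm))

theorem Walk.ncard_arcs_out [DecidableEq V] {u v : V} {p : G.Walk u v} (hp : p.IsTrail) (x : V) :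
    {y | p.arcs.Adj x y}.ncard = p.support.dropLast.count x := by
  have h : ∀ y, p.arcs.Adj x y ↔ p.reverse.arcs.Adj y x := fun y => by
    simp only [arcs, mem_darts_reverse]
    exact ⟨fun ⟨h, hd⟩ => ⟨h.symm, hd⟩, fun ⟨h, hd⟩ => ⟨h.symm, hd⟩⟩
  simp only [h]
  rw [ncard_arcs_in hp.reverse, support_reverse, List.tail_reverse, List.count_reverse]

/-- A closed trail, directed along the way it is traversed, is an Eulerian orientation of its
edges. -/
theorem Walk.IsTrail.isEulerianOrientation {u : V} {p : G.Walk u u} (hp : p.IsTrail) :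
    IsEulerianOrientation (fromEdgeSet {e | e ∈ p.edges}) p.arcs where
  isEdge x y := by
    rintro ⟨h, hd⟩
    exact (fromEdgeSet_adj _).2 ⟨List.mem_map_of_mem (f := Dart.edge) hd, h.ne⟩
  oriented x y h := by
    have key : ∀ x y, p.arcs.Adj x y → ¬ p.arcs.Adj y x := by
      rintro x y ⟨h, hd⟩ ⟨h', hd'⟩
      have := List.inj_on_of_nodup_map hp.edges_nodup hd hd' (by simp [Dart.edge, Sym2.eq_swap])
      simp only [Dart.mk.injEq, Prod.mk.injEq] at this
      exact h.ne this.1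
    obtain ⟨⟨d, h'⟩, hd, he⟩ := List.mem_map.1 ((fromEdgeSet_adj _).1 h).1
    rcases Sym2.eq_iff.1 he with ⟨rfl, rfl⟩ | ⟨rfl, rfl⟩
    · exact Or.inl ⟨⟨h', hd⟩, key _ _ ⟨h', hd⟩⟩
    · exact Or.inr ⟨⟨h', hd⟩, key _ _ ⟨h', hd⟩⟩
  balanced x := by
    classical
    rw [ncard_arcs_in hp, ncard_arcs_out hp]
    exact p.tail_support_perm_dropLast_support.count_eq x

/-- Every finite graph is the union of a subgraph with an Eulerian orientation and a forest. -/
theorem exists_isEulerianOrientation_isAcyclic_sdiff [Finite V] (G : SimpleGraph V) :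
    ∃ (C : SimpleGraph V) (D : Digraph V), C ≤ G ∧ IsEulerianOrientation C D ∧
      (G \ C).IsAcyclic := by
  obtain ⟨C, ⟨hCG, D, hD⟩, hmax⟩ := Set.Finite.exists_maximal
    (Set.toFinite {C : SimpleGraph V | C ≤ G ∧ ∃ D, IsEulerianOrientation C D})
    ⟨⊥, bot_le, ⊥, IsEulerianOrientation.bot⟩
  refine ⟨C, D, hCG, hD, fun u p hp => ?_⟩
  -- A cycle left outside `C` could be oriented along itself and added to `C`, against maximality.
  set P := fromEdgeSet {e | e ∈ p.edges} with hP
  have hPG : P ≤ G \ C := fun x y h => p.adj_of_mem_edges ((fromEdgeSet_adj _).1 h).1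
  have hsup := hD.sup hp.isTrail.isEulerianOrientation fun x y h h' => (hPG h').2 h
  have hle := hmax ⟨sup_le hCG (hPG.trans sdiff_le), _, hsup⟩ le_sup_left
  obtain ⟨v, h, q, rfl⟩ := Walk.not_nil_iff.1 hp.not_nil
  have hadj : P.Adj u v := (fromEdgeSet_adj _).2 ⟨by simp, h.ne⟩
  exact (hPG hadj).2 (hle (Or.inr hadj))

theorem IsAcyclic.ncard_edgeSet_le [Fintype V] (h : G.IsAcyclic) :
    G.edgeSet.ncard ≤ Fintype.card V := by
  classical
  cases isEmpty_or_nonempty V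
  · rw [Subsingleton.elim G ⊥]; simp
  · obtain ⟨T, hGT, -, hT⟩ := Connected.exists_isTree_le_of_le_of_isAcyclic
      (connected_top (V := V)) le_top h
    have hc := hT.card_edgeFinset
    have := Set.ncard_le_ncard (edgeSet_mono hGT) (Set.toFinite _)
    rw [← coe_edgeFinset T, Set.ncard_coe_finset] at this
    omega

/-- If there is an edge, the start of a longest path has degree one: a neighbour on the path must be
the next vertex by acyclicity, and a neighbour off the path would extend it. -/
theorem IsAcyclic.eq_bot_of_even [Finite V] (h : G.IsAcyclic)
    (heven : ∀ v, Even (G.neighborSet v).ncard) : G = ⊥ := by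
  by_contra hne
  obtain ⟨a, b, hab⟩ := ne_bot_iff_exists_adj.1 hne
  have : Nonempty V := ⟨a⟩
  have hfin : G.edgeSet.Finite := Set.toFinite _
  have : Finite G.edgeSet := hfin
  obtain ⟨u, v, p, hp, hmax⟩ := Walk.exists_isPath_forall_isPath_length_le_length G
  have hlen : 1 ≤ p.length := hmax _ _ hab.toWalk (by simp [hab.ne])
  have hnil : ¬ p.Nil := by
    intro hn
    have := Walk.length_eq_zero_iff.2 hn
    omega
  have hs : G.neighborSet u = {p.snd} := by
    ext w
    simp only [mem_neighborSet, Set.mem_singleton_iff]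
    constructor
    · intro hw
      by_cases hws : w ∈ p.support
      · exact h.eq_snd_of_adj_start hp hw hws
      · have := hmax _ _ (Walk.cons hw.symm p) (hp.cons hws)
        simp at this
    · rintro rfl
      exact p.adj_snd hnil
  have := heven u
  rw [hs, Set.ncard_singleton] at this
  exact absurd this (by decide)

end SimpleGraph

/-! ### Knowledge of nodes as functions of their histories. -/

namespace CongestedClique

variable {n b B : ℕ}

/-- An input graph on `n` nodes, with distinct identifiers of `B` bits and a port numbering. -/
structure Network (n B : ℕ) where
  graph : SimpleGraph (Fin n)
  decAdj : DecidableRel graph.Adj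
  ids : Fin n → ℕ
  ports : PortNumbering n
  ids_injective : Function.Injective ids
  ids_lt : ∀ v, ids v < 2 ^ B

/-- The input of the node `v`. -/
def Network.input (I : Network n B) (v : Fin n) : LocalInput n :=
  haveI := I.decAdj
  localInput I.graph I.ids I.ports v

/-- All that a node has seen: its input and the messages of the past rounds, the latest first. -/
abbrev History (n b : ℕ) : Type :=
  LocalInput n × List (Fin (n - 1) → Fin b → Bool)

/-- A rule that determines the messages of a node from all that it has seen. -/
abbrev SendRule (n b : ℕ) : Type :=
  History n b → Fin (n - 1) → Fin b → Bool

/-- What the node `v` has seen after `t` rounds in which all nodes follow the rule `s`. -/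
def SendRule.history (s : SendRule n b) (I : Network n B) : ℕ → Fin n → History n b
  | 0, v => (I.input v, [])
  | t + 1, v => ((s.history I t v).1,
      (fun p => s (s.history I t (I.ports v p))
        (I.ports.portTo (I.ports v p) v (I.ports v p).2.symm)) :: (s.history I t v).2)

theorem SendRule.length_history (s : SendRule n b) (I : Network n B) (t : ℕ) (v : Fin n) :
    (s.history I t v).2.length = t := by
  induction t with
  | zero => rfl
  | succ t ih => simp [history, ih]

/-- The algorithm in which nodes remember all that they have seen, send messages by the rules `s`,
and stop with the outputs `g`. -/
def fullInformation (b : ℕ → ℕ) (s : ∀ n, SendRule n (b n))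
    (g : ∀ n, History n (b n) → Fin (n - 1) → Bool) : Algorithm b where
  State n := History n (b n)
  init _ x := (x, [])
  send n := s n
  receive _ h m := (h.1, m :: h.2)
  output n := g n

theorem run_fullInformation {b : ℕ → ℕ} (s : ∀ n, SendRule n (b n))
    (g : ∀ n, History n (b n) → Fin (n - 1) → Bool) (I : Network n B) (t : ℕ) :
    haveI := I.decAdj
    (fullInformation b s g).run I.graph I.ids I.ports t = (s n).history I t := by
  induction t with
  | zero => rfl
  | succ t ih =>
    unfold Algorithm.run at ih ⊢
    rw [Function.iterate_succ_apply', ih]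
    rfl

/-- The nodes can get to know the values `f I v` within `t` rounds, with messages of `b` bits. -/
def Computable (b t : ℕ) {X : Type*} (f : Network n B → Fin n → X) : Prop :=
  ∃ s : SendRule n b, Function.FactorsThrough (fun a : Network n B × Fin n => f a.1 a.2)
    fun a => s.history a.1 t a.2

theorem computable_input : Computable b 0 (Network.input : Network n B → Fin n → LocalInput n) :=
  ⟨fun _ _ _ => false, fun _ _ h => congrArg Prod.fst h⟩

theorem Computable.mono {t : ℕ} {X Y : Type*} {f : Network n B → Fin n → X}
    {g : Network n B → Fin n → Y} (hf : Computable b t f)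
    (h : ∀ I v I' v', f I v = f I' v' → g I v = g I' v') : Computable b t g := by
  obtain ⟨s, hs⟩ := hf
  exact ⟨s, fun a a' haa' => h _ _ _ _ (hs haa')⟩

/-- In one round, the nodes can exchange messages that depend on what they know. -/
theorem Computable.round {t : ℕ} {X M : Type*} [Fintype M] (hM : Fintype.card M ≤ 2 ^ b)
    {f : Network n B → Fin n → X} (hf : Computable b t f) (m : X → Fin (n - 1) → M) :
    Computable b (t + 1) fun I v => (f I v, fun p =>
      m (f I (I.ports v p)) (I.ports.portTo (I.ports v p) v (I.ports v p).2.symm)) := by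
  classical
  obtain ⟨s, hs⟩ := hf
  obtain ⟨enc⟩ : Nonempty (M ↪ (Fin b → Bool)) :=
    Function.Embedding.nonempty_of_card_le (by simpa using hM)
  rcases isEmpty_or_nonempty (Network n B × Fin n) with he | ⟨⟨a₀⟩⟩
  · exact ⟨s, fun a => he.elim a⟩
  have : Nonempty X := ⟨f a₀.1 a₀.2⟩
  obtain ⟨e, he⟩ := (Function.factorsThrough_iff _).1 hs
  have he : ∀ I v, f I v = e (s.history I t v) := fun I v => congrFun he (I, v)
  -- The length of the history is the round number, so one rule can imitate `s` for `t` rounds and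
  -- then send the new messages, computed from the history by `e`.
  set s' : SendRule n b := fun h p => if h.2.length < t then s h p else enc (m (e h) p) with hs'
  have hist : ∀ k ≤ t, ∀ (I : Network n B) v, s'.history I k v = s.history I k v := by
    intro k
    induction k with
    | zero => intros; rfl
    | succ k ih =>
      intro hk I v
      have hlt : ∀ w, (s.history I k w).2.length < t := fun w => by
        rw [s.length_history]; omega
      simp only [SendRule.history, ih (by omega) I]
      simp only [hs', hlt, if_true]
  have hnot : ∀ (I : Network n B) w, ¬ (s.history I t w).2.length < t := fun I w => by
    rw [s.length_history]; omega
  refine ⟨s', ?_⟩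
  rintro ⟨I, v⟩ ⟨I', v'⟩ h
  simp only [SendRule.history, hist t le_rfl] at h
  simp only [hs', hnot, if_false, ← he, Prod.mk.injEq, List.cons.injEq] at h
  obtain ⟨h₁, h₂, h₃⟩ := h
  refine Prod.ext (hs (Prod.ext h₁ h₃)) (funext fun p => ?_)
  exact enc.injective (congrFun h₂ p)

/-! ### Ranks of identifiers. -/

namespace Network

variable (I : Network n B)

/-- The rank of a node is the number of nodes with a smaller identifier. -/
noncomputable def rank : Fin n ≃ Fin n :=
  Equiv.ofBijective (fun v => ⟨((Finset.univ.image I.ids).filter (· < I.ids v)).card, by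
      have h : (Finset.univ.image I.ids).filter (· < I.ids v) ⊂ Finset.univ.image I.ids :=
        Finset.filter_ssubset.2 ⟨I.ids v, by simp, lt_irrefl _⟩
      exact (Finset.card_lt_card h).trans_le (Finset.card_image_le.trans (by simp))⟩) <| by
    refine Finite.injective_iff_bijective.1 fun v w h => I.ids_injective ?_
    have key : ∀ v w, I.ids v < I.ids w →
        ((Finset.univ.image I.ids).filter (· < I.ids v)).card <
          ((Finset.univ.image I.ids).filter (· < I.ids w)).card := by
      intro v w hvw
      refine Finset.card_lt_card (Finset.ssubset_iff_of_subset ?_ |>.2 ⟨I.ids v, by simp [hvw]⟩)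
      exact Finset.monotone_filter_right _ fun x _ hx => lt_trans hx hvw
    have h := congrArg Fin.val h
    rcases lt_trichotomy (I.ids v) (I.ids w) with hlt | heq | hgt
    · exact absurd h (key v w hlt).ne
    · exact heq
    · exact absurd h (key w v hgt).ne'

/-- Comparing two networks is what `Computable` requires: the rank is determined by data that a node
sees after one round. -/
theorem rank_eq_rank {I I' : Network n B} {v v' : Fin n}
    (h : Finset.univ.image I.ids = Finset.univ.image I'.ids) (hv : I.ids v = I'.ids v') :
    I.rank v = I'.rank v' := by
  apply Fin.ext
  change ((Finset.univ.image I.ids).filter (· < I.ids v)).card =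
    ((Finset.univ.image I'.ids).filter (· < I'.ids v')).card
  rw [h, hv]

theorem exists_port_eq (I : Network n B) {v w : Fin n} (h : w ≠ v) :
    ∃ p, (I.ports v p : Fin n) = w :=
  ⟨(I.ports v).symm ⟨w, h⟩, by simp⟩

theorem image_ids (v : Fin n) : Finset.univ.image I.ids =
    insert (I.ids v) (Finset.univ.image fun p => I.ids (I.ports v p)) := by
  ext x
  simp only [Finset.mem_image, Finset.mem_univ, true_and, Finset.mem_insert]
  constructor
  · rintro ⟨w, rfl⟩
    by_cases h : w = v
    · exact Or.inl (by rw [h])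
    · obtain ⟨p, hp⟩ := I.exists_port_eq h
      exact Or.inr ⟨p, by rw [hp]⟩
  · rintro (rfl | ⟨p, rfl⟩)
    exacts [⟨_, rfl⟩, ⟨_, rfl⟩]

/-- What a node knows when all identifiers have been exchanged: its input, its rank and the ranks
of the nodes at its links. -/
noncomputable def view (v : Fin n) : LocalInput n × Fin n × (Fin (n - 1) → Fin n) :=
  (I.input v, I.rank v, fun p => I.rank (I.ports v p))

/-- The input graph, with the nodes renamed by their ranks. -/
noncomputable def rankGraph : SimpleGraph (Fin n) :=
  I.graph.comap I.rank.symm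

theorem rankGraph_adj (u v : Fin n) :
    I.rankGraph.Adj (I.rank u) (I.rank v) ↔ I.graph.Adj u v := by
  simp [rankGraph]

end Network

/-- Everyone sends its identifier over every link. The reduction modulo `2 ^ B` loses nothing by
`ids_lt`, and the set of all identifiers fixes all ranks. -/
theorem computable_view (hB : B ≤ b) :
    Computable b 1 (Network.view : Network n B → Fin n → _) := by
  have h := (computable_input (n := n) (b := b) (B := B)).round (M := Fin (2 ^ B))
    (by simpa using Nat.pow_le_pow_right two_pos hB) (fun x _ => Fin.ofNat _ x.id)
  refine h.mono fun I v I' v' h => ?_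
  simp only [Prod.mk.injEq] at h
  obtain ⟨h₁, h₂⟩ := h
  have hid : I.ids v = I'.ids v' := congrArg LocalInput.id h₁
  have hids : ∀ p, I.ids (I.ports v p) = I'.ids (I'.ports v' p) := fun p => by
    have := congrArg Fin.val (congrFun h₂ p)
    simp only [Fin.val_ofNat] at this
    exact (Nat.mod_eq_of_lt (I.ids_lt _)).symm.trans
      (this.trans (Nat.mod_eq_of_lt (I'.ids_lt _)))
  have himg : Finset.univ.image I.ids = Finset.univ.image I'.ids := by
    rw [I.image_ids v, I'.image_ids v', hid]
    simp only [hids]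
  simp only [Network.view, Prod.mk.injEq]
  exact ⟨h₁, Network.rank_eq_rank himg hid, funext fun p => Network.rank_eq_rank himg (hids p)⟩

/-- Within `t` rounds, the nodes can get to know their views, and the node of rank `r` can get to
know `f I r`. -/
def RankComputable (b t : ℕ) {X : Type*} (f : Network n B → Fin n → X) : Prop :=
  Computable b t fun I v => (I.view v, f I (I.rank v))

theorem rankComputable_neighborSet (hB : B ≤ b) :
    RankComputable b 1 fun (I : Network n B) r => I.rankGraph.neighborSet r := by
  refine (computable_view hB).mono fun I v I' v' h => ?_
  rw [Prod.mk.injEq]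
  refine ⟨h, ?_⟩
  simp only [Network.view, Prod.mk.injEq] at h
  obtain ⟨h₁, h₂, h₃⟩ := h
  ext u
  obtain ⟨w, rfl⟩ := I.rank.surjective u
  by_cases hw : w = v
  · subst hw
    simp [h₂]
  obtain ⟨p, rfl⟩ := I.exists_port_eq hw
  have hp := congrFun h₃ p
  have hn := congrArg Option.isSome (congrFun (congrArg LocalInput.nbr h₁) p)
  rw [SimpleGraph.mem_neighborSet, SimpleGraph.mem_neighborSet, I.rankGraph_adj, hp,
    I'.rankGraph_adj]
  simp only [Network.input, localInput] at hn
  split_ifs at hn <;> simp_all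

namespace RankComputable

variable {t : ℕ} {X Y M : Type*} {f : Network n B → Fin n → X}

theorem map (hf : RankComputable b t f) (g : Fin n → X → Y) :
    RankComputable b t fun I r => g r (f I r) := by
  refine Computable.mono hf fun I v I' v' h => ?_
  simp only [Prod.mk.injEq] at h ⊢
  have hr : I.rank v = I'.rank v' := congrArg (fun x => x.2.1) h.1
  exact ⟨h.1, by rw [h.2, hr]⟩

theorem congr {f' : Network n B → Fin n → X} (hf : RankComputable b t f)
    (h : ∀ I r, f I r = f' I r) :
    RankComputable b t f' := by
  have : f = f' := funext fun I => funext (h I)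
  rwa [← this]

/-- In one round, the nodes can exchange messages that depend on what they know and on the ranks of
the sender and of the receiver. -/
theorem round [Fintype M] (hM : Fintype.card M ≤ 2 ^ b) (hf : RankComputable b t f)
    (m : Fin n → X → Fin n → M) :
    RankComputable b (t + 1) fun I r => (f I r, fun u => m u (f I u) r) := by
  refine Computable.mono (Computable.round hM hf
    fun x p => m x.1.2.1 x.2 (x.1.2.2 p)) fun I v I' v' h => ?_
  simp only [Prod.mk.injEq] at h ⊢
  obtain ⟨⟨h₁, h₂⟩, h₃⟩ := h
  have hr : I.rank v = I'.rank v' := congrArg (fun x => x.2.1) h₁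
  refine ⟨h₁, h₂, funext fun u => ?_⟩
  obtain ⟨w, rfl⟩ := I.rank.surjective u
  by_cases hw : w = v
  · subst hw
    rw [h₂, hr]
  obtain ⟨p, rfl⟩ := I.exists_port_eq hw
  have hp : I.rank (I.ports v p) = I'.rank (I'.ports v' p) :=
    congrFun (congrArg (fun x => x.2.2) h₁) p
  have := congrFun h₃ p
  simp only [Network.view, PortNumbering.portTo, Equiv.apply_symm_apply] at this
  rw [this, hp]

/-- In two rounds, every node can obtain a vector of `n` messages from one other node. -/
theorem pull [Fintype M] (hM : Fintype.card M ≤ 2 ^ b) (hf : RankComputable b t f)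
    (σ : Fin n → Fin n) (x : X → Fin n → M) :
    RankComputable b (t + 2) fun I r => (f I r, x (f I (σ r))) :=
  -- Every node first scatters its vector, entry `u` to node `u`; then `u` forwards to each `r` the
  -- entry that came from `σ r`. Each link carries one message per round even if many nodes pull
  -- from the same source, and `σ` is known to all.
  ((hf.round hM fun _ => x).round hM fun _ y r => y.2 (σ r)).map fun _ y => (y.1.1, y.2)

end RankComputable

end CongestedClique

/-! ### The block decomposition and its invariants. -/

namespace SimpleGraph

section EulerPart

variable {V : Type*} [Finite V] (U : SimpleGraph V)

/-- A subgraph of `U` with an Eulerian orientation, such that the other edges form a forest. -/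
noncomputable def eulerPart : SimpleGraph V :=
  U.exists_isEulerianOrientation_isAcyclic_sdiff.choose

/-- An Eulerian orientation of `U.eulerPart`. -/
noncomputable def eulerArcs : Digraph V :=
  U.exists_isEulerianOrientation_isAcyclic_sdiff.choose_spec.choose

theorem eulerPart_le : U.eulerPart ≤ U :=
  U.exists_isEulerianOrientation_isAcyclic_sdiff.choose_spec.choose_spec.1

theorem isEulerianOrientation_eulerArcs : IsEulerianOrientation U.eulerPart U.eulerArcs :=
  U.exists_isEulerianOrientation_isAcyclic_sdiff.choose_spec.choose_spec.2.1

theorem isAcyclic_sdiff_eulerPart : (U \ U.eulerPart).IsAcyclic :=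
  U.exists_isEulerianOrientation_isAcyclic_sdiff.choose_spec.choose_spec.2.2

end EulerPart

variable {n : ℕ}

/-- The graph with the edges listed in `x`. -/
def decodeEdges (x : Fin n → Option (Sym2 (Fin n))) : SimpleGraph (Fin n) :=
  fromEdgeSet {e | ∃ i, x i = some e}

theorem exists_decodeEdges_eq {G : SimpleGraph (Fin n)} (h : G.edgeSet.ncard ≤ n) :
    ∃ x, decodeEdges x = G := by
  classical
  refine ⟨fun i => G.edgeFinset.toList[(i : ℕ)]?, ?_⟩
  have hlen : G.edgeFinset.toList.length ≤ n := by
    rwa [Finset.length_toList, ← Set.ncard_coe_finset, coe_edgeFinset]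
  have : {e | ∃ i : Fin n, G.edgeFinset.toList[(i : ℕ)]? = some e} = G.edgeSet := by
    ext e
    rw [Set.mem_ofPred_eq, ← mem_edgeFinset, ← Finset.mem_toList, List.mem_iff_getElem?]
    constructor
    · rintro ⟨i, hi⟩
      exact ⟨i, hi⟩
    · rintro ⟨i, hi⟩
      have := (List.getElem?_eq_some_iff.1 hi).1
      exact ⟨⟨i, by omega⟩, hi⟩
  rw [decodeEdges, this, fromEdgeSet_edgeSet]

open Classical in
/-- A list of the edges of a graph on `n` nodes with at most `n` edges. -/
noncomputable def encodeEdges (G : SimpleGraph (Fin n)) : Fin n → Option (Sym2 (Fin n)) :=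
  if h : G.edgeSet.ncard ≤ n then (exists_decodeEdges_eq h).choose else fun _ => none

theorem decodeEdges_encodeEdges {G : SimpleGraph (Fin n)} (h : G.edgeSet.ncard ≤ n) :
    decodeEdges (encodeEdges G) = G := by
  rw [encodeEdges, dif_pos h]
  exact (exists_decodeEdges_eq h).choose_spec

variable (H : SimpleGraph (Fin n))

/-- The edges `uv` of `H` for which `min u v` is in the `j`-th block of `2 ^ k` consecutive
nodes. -/
def block (k j : ℕ) : SimpleGraph (Fin n) where
  Adj u v := H.Adj u v ∧ (min u v : Fin n).val / 2 ^ k = j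
  symm := ⟨fun u v h => by rwa [H.adj_comm, min_comm]⟩
  loopless := ⟨fun v h => H.loopless.irrefl v h.1⟩

/-- The edges of the `j`-th block of level `k` that are not yet oriented: two blocks are merged by
orienting an Eulerian subgraph of the edges left in them such that a forest remains. -/
noncomputable def forest : ℕ → ℕ → SimpleGraph (Fin n)
  | 0, j => H.block 0 j
  | k + 1, j => (forest k (2 * j) ⊔ forest k (2 * j + 1)) \
      (forest k (2 * j) ⊔ forest k (2 * j + 1)).eulerPart

/-- The arcs chosen in the `j`-th block of level `k` and in its subblocks. -/
noncomputable def blockArcs : ℕ → ℕ → Digraph (Fin n)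
  | 0, _ => ⊥
  | k + 1, j => (blockArcs k (2 * j) ⊔ blockArcs k (2 * j + 1)) ⊔
      (H.forest k (2 * j) ⊔ H.forest k (2 * j + 1)).eulerArcs

/-- The arcs chosen in the blocks of level at most `k` that contain `r`. -/
noncomputable def nodeArcs : ℕ → ℕ → Digraph (Fin n)
  | 0, _ => ⊥
  | k + 1, r => nodeArcs k r ⊔ (H.forest k (2 * (r / 2 ^ (k + 1))) ⊔
      H.forest k (2 * (r / 2 ^ (k + 1)) + 1)).eulerArcs

theorem block_succ (k j : ℕ) : H.block (k + 1) j = H.block k (2 * j) ⊔ H.block k (2 * j + 1) := by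
  ext u v
  simp only [block, sup_adj, pow_succ, ← Nat.div_div_eq_div_mul]
  rw [← and_or_left]
  refine and_congr_right fun _ => ?_
  omega

theorem forest_le_block (k j : ℕ) : H.forest k j ≤ H.block k j := by
  induction k generalizing j with
  | zero => exact le_rfl
  | succ k ih =>
    rw [block_succ]
    exact sdiff_le.trans (sup_le_sup (ih _) (ih _))

/-- The invariant of the merging: the orientations of the two subblocks and that of the new Eulerian
part live on pairwise disjoint edge sets, so their union stays balanced. -/
theorem isEulerianOrientation_blockArcs (k j : ℕ) :
    IsEulerianOrientation (H.block k j \ H.forest k j) (H.blockArcs k j) := by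
  induction k generalizing j with
  | zero =>
    rw [forest, sdiff_self]
    exact IsEulerianOrientation.bot
  | succ k ih =>
    have hd : ∀ u v, (H.block k (2 * j)).Adj u v → ¬ (H.block k (2 * j + 1)).Adj u v := by
      rintro u v ⟨-, h⟩ ⟨-, h'⟩
      omega
    have hl : ∀ i u v, (H.forest k i).Adj u v → (H.block k i).Adj u v :=
      fun i u v h => H.forest_le_block k i h
    have hl₀ := hl (2 * j)
    have hl₁ := hl (2 * j + 1)
    have hU := eulerPart_le (H.forest k (2 * j) ⊔ H.forest k (2 * j + 1))
    have hU : ∀ u v, _ → _ := fun u v h => @hU u v h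
    have h := ((ih (2 * j)).sup (ih (2 * j + 1)) ?_).sup (isEulerianOrientation_eulerArcs
      (H.forest k (2 * j) ⊔ H.forest k (2 * j + 1))) ?_
    · refine (congrArg (IsEulerianOrientation · (H.blockArcs (k + 1) j)) ?_).mpr h
      rw [block_succ, forest]
      ext u v
      specialize hd u v
      specialize hl₀ u v
      specialize hl₁ u v
      specialize hU u v
      simp only [sdiff_adj, sup_adj] at hU ⊢
      tauto
    · intro u v h h'
      exact hd u v h.1 h'.1
    · intro u v h h'
      specialize hd u v
      specialize hl₀ u v
      specialize hl₁ u v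
      have := hU u v h'
      simp only [sdiff_adj, sup_adj] at h this
      tauto

/-- At each level the edge `uv` lies only in the block containing `min u v`, so the record of that
node alone determines its direction. -/
theorem blockArcs_adj_iff (k : ℕ) (u v : Fin n) :
    (H.blockArcs k ((min u v : Fin n).val / 2 ^ k)).Adj u v ↔
      (H.nodeArcs k (min u v : Fin n)).Adj u v := by
  induction k with
  | zero => rfl
  | succ k ih =>
    have hne : ∀ j, j ≠ (min u v : Fin n).val / 2 ^ k → ¬ (H.blockArcs k j).Adj u v :=
      fun j hj h => hj ((H.isEulerianOrientation_blockArcs k j).isEdge u v h).1.2.symm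
    have hdiv : (min u v : Fin n).val / 2 ^ (k + 1) = (min u v : Fin n).val / 2 ^ k / 2 := by
      rw [pow_succ, Nat.div_div_eq_div_mul]
    simp only [blockArcs, nodeArcs, Digraph.sup_adj, ← ih]
    refine or_congr_left ?_
    rcases Nat.mod_two_eq_zero_or_one ((min u v : Fin n).val / 2 ^ k) with h | h
    · have h₀ : 2 * ((min u v : Fin n).val / 2 ^ (k + 1)) = (min u v : Fin n).val / 2 ^ k := by omega
      have := hne (2 * ((min u v : Fin n).val / 2 ^ (k + 1)) + 1) (by omega)
      rw [h₀] at this ⊢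
      tauto
    · have h₁ : 2 * ((min u v : Fin n).val / 2 ^ (k + 1)) + 1 = (min u v : Fin n).val / 2 ^ k := by
        omega
      have := hne (2 * ((min u v : Fin n).val / 2 ^ (k + 1))) (by omega)
      rw [h₁]
      tauto

theorem ncard_edgeSet_forest_le (k j : ℕ) : (H.forest k j).edgeSet.ncard ≤ n := by
  cases k with
  | zero =>
    -- At level 0 the remainder need not come from a merge: it is a star at `j`, or empty when there
    -- is no node `j`.
    by_cases hj : j < n
    · have hsub : (H.forest 0 j).edgeSet ⊆ Set.range fun v : Fin n => s(⟨j, hj⟩, v) := by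
        intro e
        induction e with
        | _ u v =>
          rintro ⟨-, h⟩
          rw [pow_zero, Nat.div_one] at h
          rcases min_choice u v with h' | h'
          · exact ⟨v, by rw [← (Fin.ext (h' ▸ h) : u = ⟨j, hj⟩)]⟩
          · exact ⟨u, by rw [← (Fin.ext (h' ▸ h) : v = ⟨j, hj⟩), Sym2.eq_swap]⟩
      refine (Set.ncard_le_ncard hsub (Set.toFinite _)).trans ?_
      rw [← Set.image_univ]
      exact (Set.ncard_image_le (Set.toFinite _)).trans (by simp [Set.ncard_univ])
    · have : H.forest 0 j = ⊥ := by
        rw [eq_bot_iff]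
        rintro u v ⟨-, h⟩
        rw [pow_zero, Nat.div_one] at h
        exact absurd (h ▸ (min u v : Fin n).isLt) hj
      simp [this]
  | succ k =>
    exact (isAcyclic_sdiff_eulerPart
      (H.forest k (2 * j) ⊔ H.forest k (2 * j + 1))).ncard_edgeSet_le.trans_eq (Fintype.card_fin n)

theorem forest_eq_bot_of_le {k j : ℕ} (h : n ≤ j * 2 ^ k) : H.forest k j = ⊥ := by
  rw [eq_bot_iff]
  refine (H.forest_le_block k j).trans ?_
  rintro u v ⟨-, h'⟩
  have := (Nat.div_lt_iff_lt_mul (Nat.two_pow_pos k)).2 ((min u v : Fin n).isLt.trans_le h)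
  omega

theorem block_eq_self {k : ℕ} (h : n < 2 ^ k) : H.block k 0 = H := by
  ext u v
  exact and_iff_left (Nat.div_eq_of_lt ((min u v : Fin n).isLt.trans h))

/-- If all degrees are even, then the orientation of the block of all nodes is complete. -/
theorem isEulerianOrientation_nodeArcs (heven : ∀ v, Even (H.neighborSet v).ncard) {k : ℕ}
    (h : n < 2 ^ (k + 1)) :
    IsEulerianOrientation H ⟨fun u v => (H.nodeArcs (k + 1) (min u v : Fin n)).Adj u v⟩ := by
  have hle := H.forest_le_block (k + 1) 0
  have hD := H.isEulerianOrientation_blockArcs (k + 1) 0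
  rw [H.block_eq_self h] at hle hD
  -- The oriented part has even degrees, hence so has its complement in `H`. The level is `k + 1`
  -- because only from level 1 on is the remainder acyclic by construction.
  have hbot : H.forest (k + 1) 0 = ⊥ := by
    refine IsAcyclic.eq_bot_of_even (isAcyclic_sdiff_eulerPart _) fun v => ?_
    have hs : (H \ H.forest (k + 1) 0).neighborSet v =
      H.neighborSet v \ (H.forest (k + 1) 0).neighborSet v := rfl
    have he := hD.even_ncard_neighborSet v
    rw [hs] at he
    have hc := Set.ncard_sdiff_add_ncard_of_subset
      (show (H.forest (k + 1) 0).neighborSet v ⊆ H.neighborSet v from fun u hu => hle hu)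
    have := heven v
    rw [← hc, Nat.even_add] at this
    exact this.1 he
  rw [hbot, sdiff_bot] at hD
  convert hD using 1
  ext u v
  rw [← blockArcs_adj_iff, Nat.div_eq_of_lt ((min u v : Fin n).isLt.trans h)]

end SimpleGraph

/-! ### Executing the merges in the clique. -/

namespace CongestedClique

variable {n b B : ℕ}

/-- After `k` phases of four rounds, every node knows what is left of its block of level `k`, and
the arcs that have been chosen in its blocks so far. -/
theorem rankComputable_forest (hB : B ≤ b)
    (hb : Fintype.card (Option (Sym2 (Fin n))) ≤ 2 ^ b) (k : ℕ) :
    RankComputable b (4 * k + 1) fun (I : Network n B) r =>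
      (I.rankGraph.forest k (r / 2 ^ k), I.rankGraph.nodeArcs k r) := by
  classical
  induction k with
  | zero =>
    refine ((rankComputable_neighborSet hB).map fun r s =>
      (SimpleGraph.fromEdgeSet {e | ∃ u ∈ s, r ≤ u ∧ e = s(r, u)}, ⊥)).congr fun I r => ?_
    refine Prod.ext ?_ rfl
    ext u v
    simp only [SimpleGraph.fromEdgeSet_adj, Set.mem_ofPred_eq, SimpleGraph.mem_neighborSet,
      SimpleGraph.forest, SimpleGraph.block, pow_zero, Nat.div_one]
    constructor
    · rintro ⟨⟨w, hw, hle, he⟩, -⟩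
      rcases Sym2.eq_iff.1 he with ⟨rfl, rfl⟩ | ⟨rfl, rfl⟩
      · exact ⟨hw, by rw [min_eq_left hle]⟩
      · exact ⟨hw.symm, by rw [min_eq_right hle]⟩
    · rintro ⟨h, hr⟩
      refine ⟨?_, h.ne⟩
      have hr := Fin.ext hr
      rcases le_total u v with hle | hle
      · rw [min_eq_left hle] at hr
        subst hr
        exact ⟨v, h, hle, rfl⟩
      · rw [min_eq_right hle] at hr
        subst hr
        exact ⟨u, h.symm, hle, Sym2.eq_swap⟩
  | succ k ih =>
    -- The first node of subblock `i` serves as source. A subblock may start beyond `n`; the source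
    -- is then a dummy, and `fetch` ignores its message and returns the correct value `⊥`.
    set σ : ℕ → Fin n → Fin n := fun i r =>
      if h : (2 * (r / 2 ^ (k + 1)) + i) * 2 ^ k < n then ⟨_, h⟩ else r with hσ
    set fetch : ℕ → Fin n → (Fin n → Option (Sym2 (Fin n))) → SimpleGraph (Fin n) := fun i r x =>
      if (2 * (r / 2 ^ (k + 1)) + i) * 2 ^ k < n then SimpleGraph.decodeEdges x else ⊥ with hfetch
    have key : ∀ (H : SimpleGraph (Fin n)) i r,
        fetch i r (SimpleGraph.encodeEdges (H.forest k (σ i r / 2 ^ k))) =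
          H.forest k (2 * (r / 2 ^ (k + 1)) + i) := by
      intro H i r
      by_cases h : (2 * (r / 2 ^ (k + 1)) + i) * 2 ^ k < n
      · have hσr : (σ i r : ℕ) / 2 ^ k = 2 * (r / 2 ^ (k + 1)) + i := by
          simp only [hσ, dif_pos h]
          exact Nat.mul_div_cancel _ (Nat.two_pow_pos k)
        rw [hσr]
        simp only [hfetch, if_pos h]
        exact SimpleGraph.decodeEdges_encodeEdges (H.ncard_edgeSet_forest_le _ _)
      · simp only [hfetch, if_neg h]
        exact (H.forest_eq_bot_of_le (not_lt.1 h)).symm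
    refine (((ih.pull hb (σ 0) fun y => SimpleGraph.encodeEdges y.1).pull hb (σ 1)
      fun y => SimpleGraph.encodeEdges y.1.1).map fun r y =>
        let U := fetch 0 r y.1.2 ⊔ fetch 1 r y.2
        (U \ U.eulerPart, y.1.1.2 ⊔ U.eulerArcs)).congr fun I r => ?_
    simp only [key]
    rfl

/-- In one more round, all nodes get to know the directions of their edges. -/
theorem rankComputable_orientation (hB : B ≤ b)
    (hb : Fintype.card (Option (Sym2 (Fin n))) ≤ 2 ^ b) (hb₁ : 1 ≤ b) (k : ℕ) :
    RankComputable b (4 * k + 2) fun (I : Network n B) r =>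
      {u | (I.rankGraph.nodeArcs k (min r u : Fin n)).Adj r u} := by
  classical
  -- The bit sent by `u` to `r` says whether `u` has recorded the arc from `r` to `u`. It is used
  -- only when `u < r`, where `u` owns the edge.
  refine (((rankComputable_forest hB hb k).round (M := Bool)
    (by simpa using Nat.pow_le_pow_right two_pos hb₁)
    fun u y r => decide (y.2.Adj r u)).map fun r y =>
      {u | if r ≤ u then y.1.2.Adj r u else y.2 u = true}).congr fun I r => ?_
  ext u
  simp only [Set.mem_ofPred_eq, decide_eq_true_eq]
  split_ifs with h
  · rw [min_eq_left h]
  · rw [min_eq_right (le_of_not_ge h)]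

theorem card_option_sym2_le (n : ℕ) :
    Fintype.card (Option (Sym2 (Fin n))) ≤ 2 ^ (2 * Nat.log 2 n + 2) := by
  have h₁ : Fintype.card (Sym2 (Fin n)) ≤ n * n := by
    have := Fintype.card_le_of_surjective (fun p : Fin n × Fin n => s(p.1, p.2))
      (by rintro ⟨a, b⟩; exact ⟨(a, b), rfl⟩)
    simpa using this
  have h₂ : n < 2 ^ (Nat.log 2 n + 1) := Nat.lt_pow_succ_log_self one_lt_two n
  have h₃ : n * n < 2 ^ (2 * Nat.log 2 n + 2) := by
    calc n * n < 2 ^ (Nat.log 2 n + 1) * 2 ^ (Nat.log 2 n + 1) := Nat.mul_self_lt_mul_self h₂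
      _ = _ := by rw [← pow_add]; congr 1; omega
  rw [Fintype.card_option]
  omega

/-- A send rule by which, after the given number of rounds, the history of every node determines the
directions of its edges in an Eulerian orientation. -/
theorem computable_output (n B : ℕ) :
    ∃ (s : SendRule n (B + (2 * Nat.log 2 n + 2)))
      (g : History n (B + (2 * Nat.log 2 n + 2)) → Fin (n - 1) → Bool),
      ∀ I : Network n B, (∀ v, Even (I.graph.neighborSet v).ncard) →
        ∃ D, IsEulerianOrientation I.graph D ∧
          ∀ v p, g (s.history I (4 * (Nat.log 2 n + 1) + 2) v) p = true ↔
            D.Adj v (I.ports v p) := by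
  classical
  have hb : Fintype.card (Option (Sym2 (Fin n))) ≤ 2 ^ (B + (2 * Nat.log 2 n + 2)) :=
    (card_option_sym2_le n).trans (Nat.pow_le_pow_right two_pos (Nat.le_add_left _ _))
  have h : Computable (B + (2 * Nat.log 2 n + 2)) (4 * (Nat.log 2 n + 1) + 2)
      fun (I : Network n B) v p => decide ((I.rankGraph.nodeArcs (Nat.log 2 n + 1)
        (min (I.rank v) (I.rank (I.ports v p)) : Fin n)).Adj (I.rank v)
        (I.rank (I.ports v p))) := by
    refine Computable.mono (rankComputable_orientation (Nat.le_add_right B _) hb (by omega)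
      (Nat.log 2 n + 1)) fun I v I' v' h => ?_
    rw [Prod.mk.injEq] at h
    obtain ⟨h₁, h₂⟩ := h
    funext p
    have hp : I.rank (I.ports v p) = I'.rank (I'.ports v' p) :=
      congrFun (congrArg (fun x => x.2.2) h₁) p
    have := Set.ext_iff.1 h₂ (I.rank (I.ports v p))
    simp only [Set.mem_ofPred_eq] at this
    rw [decide_eq_decide, this, hp]
  obtain ⟨s, hs⟩ := h
  obtain ⟨g, hg⟩ := (Function.factorsThrough_iff _).1 hs
  refine ⟨s, g, fun I heven => ?_⟩
  have hrank : I.rankGraph.comap I.rank = I.graph := by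
    ext u v
    exact I.rankGraph_adj u v
  have hH : ∀ v, Even (I.rankGraph.neighborSet v).ncard := fun v => by
    have := heven (I.rank.symm v)
    rwa [← Set.ncard_preimage_of_injective_subset_range I.rank.symm.injective (by simp)] at this
  have hD := (I.rankGraph.isEulerianOrientation_nodeArcs hH
    (Nat.lt_pow_succ_log_self one_lt_two n)).comap_equiv I.rank
  rw [hrank] at hD
  refine ⟨_, hD, fun v p => ?_⟩
  have := congrFun (congrFun hg (I, v)) p
  rw [← decide_eq_true_eq (p := Digraph.Adj _ _ _)]
  exact (congrArg (· = true) this).symm ▸ Iff.rfl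

end CongestedClique

/-! ### Asymptotics and conclusion. -/

/-- Ensures that the infimum in `logStar` is attained rather than the default 0 of an empty set.
Induction on an integer bound works because `m + 1 ≤ 2 ^ m`. -/
theorem exists_iterate_logb_le_one (x : ℝ) : ∃ k, (Real.logb 2)^[k] x ≤ 1 := by
  obtain ⟨m, hm⟩ := exists_nat_ge x
  induction m generalizing x with
  | zero => exact ⟨0, hm.trans (by simp)⟩
  | succ m ih =>
    by_cases hx : x ≤ 1
    · exact ⟨0, hx⟩
    push Not at hx
    have hle : Real.logb 2 x ≤ m := by
      rw [Real.logb_le_iff_le_rpow one_lt_two (by linarith), Real.rpow_natCast]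
      exact hm.trans (by exact_mod_cast Nat.lt_two_pow_self)
    obtain ⟨k, hk⟩ := ih _ hle
    exact ⟨k + 1, hk⟩

theorem one_le_logStar {x : ℝ} (hx : 1 < x) : 1 ≤ logStar x := by
  have hmem : (Real.logb 2)^[logStar x] x ≤ 1 := Nat.sInf_mem (exists_iterate_logb_le_one x)
  by_contra h
  rw [Nat.lt_one_iff.1 (not_le.1 h)] at hmem
  exact absurd hx (not_lt.2 hmem)

theorem isBigO_natLog : (fun n : ℕ => (Nat.log 2 n : ℝ)) =O[atTop] fun n : ℕ => Real.log n := by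
  refine IsBigO.of_bound (1 / Real.log 2) (Eventually.of_forall fun n => ?_)
  have h := Real.natLog_le_logb n 2
  rw [Real.logb, Nat.cast_ofNat] at h
  rw [Real.norm_of_nonneg (Nat.cast_nonneg _), one_div_mul_eq_div,
    Real.norm_of_nonneg (Real.log_natCast_nonneg n)]
  exact h

theorem isBigO_const_log (c : ℝ) : (fun _ : ℕ => c) =O[atTop] fun n : ℕ => Real.log n :=
  Real.isLittleO_const_log_atTop.isBigO.comp_tendsto tendsto_natCast_atTop_atTop

/-- The algorithm takes O(log n) rounds; the factor `logStar n` enters only through being eventually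
at least 1. -/
theorem isBigO_log_mul_logStar :
    (fun n : ℕ => Real.log n) =O[atTop] fun n : ℕ => Real.log n * (logStar n : ℝ) := by
  refine IsBigO.of_bound 1 ?_
  filter_upwards [eventually_gt_atTop 1] with n hn
  have h : (1 : ℝ) ≤ logStar n := by exact_mod_cast one_le_logStar (by exact_mod_cast hn)
  rw [one_mul, norm_mul, Real.norm_of_nonneg (zero_le_one.trans h)]
  exact le_mul_of_one_le_right (norm_nonneg _) h

theorem mainTheorem4 (idBits : ℕ → ℕ)
    (hid : (fun n : ℕ => (idBits n : ℝ)) =O[atTop] fun n : ℕ => Real.log n) :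
    ∃ (b : ℕ → ℕ) (A : CongestedClique.Algorithm b) (T : ℕ → ℕ),
      ((fun n : ℕ => (b n : ℝ)) =O[atTop] fun n : ℕ => Real.log n) ∧
      ((fun n : ℕ => (T n : ℝ)) =O[atTop] fun n : ℕ => Real.log n * (logStar n : ℝ)) ∧
      ∀ (n : ℕ) (G : SimpleGraph (Fin n)) [DecidableRel G.Adj] (ids : Fin n → ℕ)
        (ports : CongestedClique.PortNumbering n),
        IsEulerianGraph G → Function.Injective ids → (∀ v, ids v < 2 ^ idBits n) →
          IsEulerianOrientation G (A.outputDigraph G ids ports (T n)) := by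
  choose s g hsg using fun n => CongestedClique.computable_output n (idBits n)
  refine ⟨fun n => idBits n + (2 * Nat.log 2 n + 2), CongestedClique.fullInformation _ s g,
    fun n => 4 * (Nat.log 2 n + 1) + 2, ?_, ?_, ?_⟩
  · push_cast
    exact hid.add ((isBigO_natLog.const_mul_left 2).add (isBigO_const_log 2))
  · push_cast
    refine IsBigO.trans ?_ isBigO_log_mul_logStar
    exact ((isBigO_natLog.add (isBigO_const_log 1)).const_mul_left 4).add (isBigO_const_log 2)
  · intro n G hG ids ports heven hinj hlt
    obtain ⟨D, hD, hout⟩ := hsg n ⟨G, hG, ids, ports, hinj, hlt⟩ fun v => by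
      have := heven v
      rwa [← SimpleGraph.card_neighborSet_eq_degree, ← Nat.card_eq_fintype_card,
        Nat.card_coe_set_eq] at this
    convert hD
    ext u v
    have hrun := CongestedClique.run_fullInformation s g ⟨G, hG, ids, ports, hinj, hlt⟩
      (4 * (Nat.log 2 n + 1) + 2)
    simp only at hrun
    simp only [CongestedClique.Algorithm.outputDigraph, hrun]
    constructor
    · rintro ⟨h, ho⟩
      have := (hout u _).1 ho
      simpa [CongestedClique.PortNumbering.portTo] using this
    · intro h
      refine ⟨hD.isEdge u v h, (hout u _).2 ?_⟩
      simpa [CongestedClique.PortNumbering.portTo] using h
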